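/- Let $n \ge 4$, let $S_n$ be the symmetric group on $[n]=\{1,\dots,n\}$, and let $R_n=\mathbb{R}[X_{i,j} : 1\le i<j\le n]$ be the polynomial ring with one variable for each pair $i<j$. For $\sigma\in S_n$ put $$\mathrm{inv}_X(\sigma)=\sum_{\substack{1\le i<j\le n\\ \sigma(i)>\sigma(j)}} X_{i,j}\in R_n,$$ let $\mathfrak{I}_n=\big(\mathrm{inv}_X(\pi\tau^{-1})\big)_{\pi,\tau\in S_n}$, an $n!\times n!$ matrix over $R_n$, and put $$\Lambda=(n-2)!\sum_{1\le i<j\le n}(j-i)X_{i,j},\qquad \Delta=(n-3)!\sum_{1\le i<j\le n}\big(n-2(j-i)\big)X_{i,j},\qquad \Omega=\frac{n!}{2}\sum_{1\le i<j\le n}X_{i,j}.$$ Then the minimal polynomial of $\mathfrak{I}_n$ is $$X\,(X+\Lambda)\,(X+\Delta)\,(X-\Omega)\in R_n[X].$$ That is, this monic polynomial has the least degree among the monic polynomials in $R_n[X]$ that annihilate $\mathfrak{I}_n$, and a polynomial $q\in R_n[X]$ satisfies $q(\mathfrak{I}_n)=0$ if and only if $X(X+\Lambda)(X+\Delta)(X-\Omega)$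 divides $q$. -/

import Mathlib

namespace MultinomialInversion

/-- The pairs `(i, j)` of `[n]²` with `i < j`. The set `[n] = {1, …, n}` is modelled by `Fin n`
(all indices are shifted by one, which changes neither the order nor the differences `j - i`). -/
abbrev Pairs (n : ℕ) : Type := {p : Fin n × Fin n // p.1 < p.2}

/-- The polynomial ring `ℝ[X_{1,2}, …, X_{n-1,n}]` with one variable `X_{i,j}` for each `i < j`. -/
abbrev PolyRing (n : ℕ) : Type := MvPolynomial (Pairs n) ℝ

/-- The inversion set `INV(σ) = {(i, j) | i < j, σ(i) > σ(j)}`. -/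
def INV {n : ℕ} (σ : Equiv.Perm (Fin n)) : Finset (Pairs n) :=
  Finset.univ.filter fun p => σ p.1.1 > σ p.1.2

/-- The multinomial inversion statistic `inv_X(σ) = ∑_{(i,j) ∈ INV(σ)} X_{i,j}`. -/
noncomputable def invX {n : ℕ} (σ : Equiv.Perm (Fin n)) : PolyRing n :=
  ∑ p ∈ INV σ, MvPolynomial.X p

/-- The matrix `(inv_X(π τ⁻¹))` with rows `π` and columns `τ` in the symmetric group. -/
noncomputable def invMatrix (n : ℕ) :
    Matrix (Equiv.Perm (Fin n)) (Equiv.Perm (Fin n)) (PolyRing n) :=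
  Matrix.of fun π τ => invX (π * τ⁻¹)

/-- `Λ = (n-2)! ∑_{i<j} (j - i) X_{i,j}` (used for `n ≥ 4` only). -/
noncomputable def Lam (n : ℕ) : PolyRing n :=
  MvPolynomial.C ((n - 2).factorial : ℝ) *
    ∑ p : Pairs n, MvPolynomial.C (((p.1.2 : ℕ) : ℝ) - ((p.1.1 : ℕ) : ℝ)) * MvPolynomial.X p

/-- `Δ = (n-3)! ∑_{i<j} (n - 2(j - i)) X_{i,j}` (used for `n ≥ 4` only). -/
noncomputable def Del (n : ℕ) : PolyRing n :=
  MvPolynomial.C ((n - 3).factorial : ℝ) *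
    ∑ p : Pairs n,
      MvPolynomial.C ((n : ℝ) - 2 * (((p.1.2 : ℕ) : ℝ) - ((p.1.1 : ℕ) : ℝ))) * MvPolynomial.X p

/-- `Ω = (n!/2) ∑_{i<j} X_{i,j}`. -/
noncomputable def Om (n : ℕ) : PolyRing n :=
  MvPolynomial.C ((n.factorial : ℝ) / 2) * ∑ p : Pairs n, MvPolynomial.X p

/-- The polynomial `X (X + Λ) (X + Δ) (X - Ω)` in one variable over `ℝ[X_{1,2}, …, X_{n-1,n}]`. -/
noncomputable def quarticPoly (n : ℕ) : Polynomial (PolyRing n) :=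
  Polynomial.X * (Polynomial.X + Polynomial.C (Lam n)) * (Polynomial.X + Polynomial.C (Del n)) *
    (Polynomial.X - Polynomial.C (Om n))

end MultinomialInversion

/-!
Write `s i j ∈ {-1, 0, 1}` for the sign of `j - i`, and `x` for the skew-symmetric array with
`x i j = X_{i,j}` for `i < j`. As `[σ i > σ j] = (1 - s (σ i) (σ j)) / 2` for `i < j`,
`4 inv_X(π τ⁻¹) = 2 ∑ X_{i,j} - ∑_{a, b} s (π a) (π b) x (τ a) (τ b)`.
Up to a multiple of the all-ones matrix, the matrix therefore factors as `-(1/4) P Q` through the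
skew-symmetric functions on `[n]²`, where `P` is `signTransform` and `Q` is `varTransform`
(`four_mul_mulVec`). The all-ones part and the factored part annihilate each other, and the former
contributes the eigenvalue `Ω`.

The nonzero eigenvalues of `P Q` are those of `Q P`, which acts on the small space of
skew-symmetric `f`. Its entries are sums over `τ` of `x (τ a) (τ b) s (τ c) (τ d)`; by symmetry
for `a ≠ b` these depend, up to sign, only on `|{a, b} ∩ {c, d}|` when `c ≠ d`, and
`permSum_eq` evaluates them. The result is
`(1/4) Q P f = Δ f + γ δg`, where `g a = ∑_d f a d`, `(δg) a b = g a - g b` and `Δ + n γ = Λ`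
(`varTransform_signTransform`). On functions of the form `δh` the row-sum operation `f ↦ δg` is
multiplication by `n`, so `Q P / 4` acts as `Λ` there, and `(Q P / 4 - Λ) (Q P / 4 - Δ) = 0`. This
gives the annihilating polynomial (`aeval_quarticPoly`).

Conversely each of `0, -Λ, -Δ, Ω` has a nonzero eigenvector (`exists_eigenvector`), so it is a
root of every annihilating polynomial; since the four are distinct elements of a domain
(`eigenvalues_nodup`), the product of the linear factors divides such a polynomial.
-/

namespace MultinomialInversion

/-! ### Sums over permutations of products of two skew-symmetric arrays -/

section PermSums

variable {R : Type*} [CommRing R] {n : ℕ}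

/-- The `((a, b), (c, d))` entry of the operator `Q P`, for arbitrary arrays `x` and `s`:
the sum of `x (τ a) (τ b) * s (τ c) (τ d)` over all permutations `τ`. -/
def permSum (x s : Fin n → Fin n → R) (a b c d : Fin n) : R :=
  ∑ τ : Equiv.Perm (Fin n), x (τ a) (τ b) * s (τ c) (τ d)

variable {x s : Fin n → Fin n → R}

/-- Reindexing the sum by `τ ↦ τ * ρ`. -/
theorem permSum_perm (x s : Fin n → Fin n → R) (ρ : Equiv.Perm (Fin n)) (a b c d : Fin n) :
    permSum x s (ρ a) (ρ b) (ρ c) (ρ d) = permSum x s a b c d := by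
  unfold permSum
  rw [← Equiv.sum_comp (Equiv.mulRight ρ)
    fun τ : Equiv.Perm (Fin n) => x (τ a) (τ b) * s (τ c) (τ d)]
  simp

theorem permSum_swap_left (hx : ∀ i j, x j i = -x i j) (a b c d : Fin n) :
    permSum x s b a c d = -permSum x s a b c d := by
  simp only [permSum, ← Finset.sum_neg_distrib]
  exact Finset.sum_congr rfl fun τ _ => by rw [hx]; ring

theorem permSum_swap_right (hs : ∀ i j, s j i = -s i j) (a b c d : Fin n) :
    permSum x s a b d c = -permSum x s a b c d := by
  simp only [permSum, ← Finset.sum_neg_distrib]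
  exact Finset.sum_congr rfl fun τ _ => by rw [hs]; ring

theorem exists_perm_map_pair {a b a' b' : Fin n} (h : a ≠ b) (h' : a' ≠ b') :
    ∃ ρ : Equiv.Perm (Fin n), ρ a = a' ∧ ρ b = b' := by
  refine ⟨Equiv.swap (Equiv.swap a a' b) b' * Equiv.swap a a', ?_, ?_⟩
  · have h1 : a' ≠ Equiv.swap a a' b := by
      intro h2
      have h3 : Equiv.swap a a' a = Equiv.swap a a' b := by rw [Equiv.swap_apply_left, ← h2]
      exact h ((Equiv.swap a a').injective h3)
    rw [Equiv.Perm.mul_apply, Equiv.swap_apply_left, Equiv.swap_apply_of_ne_of_ne h1 h']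
  · rw [Equiv.Perm.mul_apply, Equiv.swap_apply_left]

variable [IsDomain R] [CharZero R]

theorem diag_eq_zero (hx : ∀ i j, x j i = -x i j) (i : Fin n) :
    x i i = 0 :=
  self_eq_neg.mp (hx i i)

/-- Under a uniform permutation, an ordered pair `(a, b)` with `a ≠ b` is sent to each ordered pair
of distinct elements equally often, namely `(n - 2)!` times. -/
theorem sum_perm_pair (F : Fin n → Fin n → R) (hF : ∀ i, F i i = 0) {a b : Fin n} (h : a ≠ b) :
    ∑ τ : Equiv.Perm (Fin n), F (τ a) (τ b) = ((n - 2).factorial : R) * ∑ i, ∑ j, F i j := by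
  have hconst : ∀ a' b', a' ≠ b' → ∑ τ : Equiv.Perm (Fin n), F (τ a') (τ b') =
      ∑ τ : Equiv.Perm (Fin n), F (τ a) (τ b) := by
    intro a' b' h'
    obtain ⟨ρ, hρa, hρb⟩ := exists_perm_map_pair h h'
    rw [← Equiv.sum_comp (Equiv.mulRight ρ) fun τ : Equiv.Perm (Fin n) => F (τ a) (τ b)]
    simp [hρa, hρb]
  have hn : 2 ≤ n := by
    by_contra hn
    exact h (Fin.ext (by omega))
  obtain ⟨m, rfl⟩ := Nat.exists_eq_add_of_le' hn
  -- Double counting: sum the left-hand side over all ordered pairs `(a, b)`.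
  have h1 : ∑ a', ∑ b', ∑ τ : Equiv.Perm (Fin (m + 2)), F (τ a') (τ b') =
      ((m + 2).factorial : R) * ∑ i, ∑ j, F i j := by
    have : ∀ τ : Equiv.Perm (Fin (m + 2)), ∑ a', ∑ b', F (τ a') (τ b') = ∑ i, ∑ j, F i j := by
      intro τ
      rw [← Equiv.sum_comp τ fun i => ∑ j, F i j]
      exact Finset.sum_congr rfl fun a' _ => Equiv.sum_comp τ fun j => F (τ a') j
    simp_rw [Finset.sum_comm (t := (Finset.univ : Finset (Equiv.Perm (Fin (m + 2)))))]
    simp [this, Fintype.card_perm]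
  have h2 : ∑ a', ∑ b', ∑ τ : Equiv.Perm (Fin (m + 2)), F (τ a') (τ b') =
      ((m + 2 : R) * (m + 1)) * ∑ τ : Equiv.Perm (Fin (m + 2)), F (τ a) (τ b) := by
    have : ∀ a', ∑ b', ∑ τ : Equiv.Perm (Fin (m + 2)), F (τ a') (τ b') =
        (m + 1 : R) * ∑ τ : Equiv.Perm (Fin (m + 2)), F (τ a) (τ b) := by
      intro a'
      rw [← Finset.add_sum_erase _ _ (Finset.mem_univ a'), Finset.sum_congr rfl
        fun b' hb' => hconst a' b' (Finset.ne_of_mem_erase hb').symm]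
      simp [hF, Finset.card_erase_of_mem]
    simp [this, mul_assoc]
  have h3 : ((m + 2 : R) * (m + 1)) ≠ 0 := by
    exact_mod_cast (by positivity : (m + 2) * (m + 1) ≠ 0)
  refine mul_left_cancel₀ h3 ?_
  rw [← h2, h1, Nat.add_sub_cancel, Nat.factorial_succ, Nat.factorial_succ]
  push_cast
  ring

theorem permSum_self (hx : ∀ i j, x j i = -x i j) {a b : Fin n} (h : a ≠ b) :
    permSum x s a b a b = ((n - 2).factorial : R) * ∑ i, ∑ j, x i j * s i j :=
  sum_perm_pair (fun i j => x i j * s i j) (fun i => by rw [diag_eq_zero hx, zero_mul]) h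

/-- Precomposition with the transposition of `c` and `d` negates the sum. -/
theorem permSum_disjoint (hs : ∀ i j, s j i = -s i j) {a b c d : Fin n} (hca : c ≠ a)
    (hcb : c ≠ b) (hda : d ≠ a) (hdb : d ≠ b) : permSum x s a b c d = 0 := by
  have h := permSum_perm x s (Equiv.swap c d) a b c d
  rw [Equiv.swap_apply_of_ne_of_ne hca.symm hda.symm,
    Equiv.swap_apply_of_ne_of_ne hcb.symm hdb.symm, Equiv.swap_apply_left, Equiv.swap_apply_right, permSum_swap_right hs] at h
  exact self_eq_neg.mp h.symm

/-- The value does not depend on `d`, so it is found from the sum over all `d`, which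
`sum_perm_pair` evaluates. -/
theorem permSum_share (hx : ∀ i j, x j i = -x i j) (hs : ∀ i j, s j i = -s i j) {a b d : Fin n}
    (hab : a ≠ b) (hda : d ≠ a) (hdb : d ≠ b) :
    permSum x s a b a d = ((n - 3).factorial : R) *
      (∑ i, ∑ j, x i j * ∑ k, s i k - ∑ i, ∑ j, x i j * s i j) := by
  have hn : 3 ≤ n := by
    simpa using (Finset.card_eq_three.mpr ⟨a, b, d, hab, hda.symm, hdb.symm, rfl⟩).symm.le.trans
      (Finset.card_le_univ ({a, b, d} : Finset (Fin n)))
  obtain ⟨m, rfl⟩ := Nat.exists_eq_add_of_le' hn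
  -- Summing over the free index `d` leaves only a sum over ordered pairs.
  have hsum : ∑ d', permSum x s a b a d' =
      ((m + 1).factorial : R) * ∑ i, ∑ j, x i j * ∑ k, s i k := by
    have := sum_perm_pair (fun i j => x i j * ∑ k, s i k)
      (fun i => by rw [diag_eq_zero hx, zero_mul]) hab
    rw [show m + 3 - 2 = m + 1 from rfl] at this
    rw [← this]
    unfold permSum
    rw [Finset.sum_comm]
    refine Finset.sum_congr rfl fun τ _ => ?_
    rw [← Finset.mul_sum, Equiv.sum_comp τ fun k => s (τ a) k]
  have hconst : ∀ d' ∈ (Finset.univ.erase a).erase b,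
      permSum x s a b a d' = permSum x s a b a d := by
    intro d' hd'
    simp only [Finset.mem_erase, Finset.mem_univ, and_true] at hd'
    have h := permSum_perm x s (Equiv.swap d d') a b a d
    rwa [Equiv.swap_apply_of_ne_of_ne hda.symm hd'.2.symm,
      Equiv.swap_apply_of_ne_of_ne hdb.symm hd'.1.symm, Equiv.swap_apply_left] at h
  have haa : permSum x s a b a a = 0 := by simp [permSum, diag_eq_zero hs]
  -- In `hsum` the term `d = a` vanishes, `d = b` is `permSum_self`, and the other `n - 2` agree.
  rw [← Finset.add_sum_erase _ _ (Finset.mem_univ a),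
    ← Finset.add_sum_erase _ _ (Finset.mem_erase.mpr ⟨hab.symm, Finset.mem_univ b⟩),
    Finset.sum_congr rfl hconst, haa, permSum_self hx hab] at hsum
  simp only [Finset.sum_const, Finset.card_erase_of_mem, Finset.mem_erase, ne_eq, hab.symm,
    not_false_eq_true, Finset.mem_univ, and_self, Finset.card_univ, Fintype.card_fin] at hsum
  rw [show m + 3 - 2 = m + 1 from rfl, show m + 3 - 1 - 1 = m + 1 from rfl, nsmul_eq_mul,
    Nat.factorial_succ] at hsum
  have hm : ((m + 1 : ℕ) : R) ≠ 0 := Nat.cast_ne_zero.mpr m.succ_ne_zero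
  refine mul_left_cancel₀ hm ?_
  rw [Nat.add_sub_cancel]
  push_cast at hsum ⊢
  linear_combination hsum

/-- All entries in terms of the two values `K` (equal pairs) and `B` (pairs sharing their first
element); the cases `c = d` are included. -/
theorem permSum_eq (hx : ∀ i j, x j i = -x i j) (hs : ∀ i j, s j i = -s i j) {a b : Fin n}
    (hab : a ≠ b) (K B : R)
    (hK : permSum x s a b a b = K)
    (hB : ∀ a b d, a ≠ b → d ≠ a → d ≠ b → permSum x s a b a d = B) (c d : Fin n) :
    permSum x s a b c d =
      B * ((if c = a then 1 else 0) - (if c = b then 1 else 0) - (if d = a then 1 else 0) +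
        (if d = b then 1 else 0)) +
      (K - 2 * B) * ((if c = a then 1 else 0) * (if d = b then 1 else 0) -
        (if c = b then 1 else 0) * (if d = a then 1 else 0)) := by
  have hdiag : ∀ c, permSum x s a b c c = 0 := fun c => by simp [permSum, diag_eq_zero hs]
  by_cases hca : c = a
  · subst hca
    by_cases hda : d = c
    · subst hda; simp [hdiag, hab]
    by_cases hdb : d = b
    · subst hdb; simp [hK, hab, hda]; ring
    · simp [hB c b d hab hda hdb, hab, hda, hdb]
  by_cases hcb : c = b
  · subst hcb
    by_cases hda : d = a
    · subst hda; rw [permSum_swap_right hs, hK]; simp [hca, hab]; ring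
    by_cases hdb : d = c
    · subst hdb; simp [hdiag, hda]
    · rw [permSum_swap_left hx, hB c a d hca hdb hda]; simp [hca, hda, hdb]
  by_cases hda : d = a
  · subst hda; rw [permSum_swap_right hs, hB d b c hab hca hcb]; simp [hca, hcb, hab]
  by_cases hdb : d = b
  · subst hdb
    rw [permSum_swap_right hs, permSum_swap_left hx, hB d a c hda hcb hca]
    simp [hca, hcb, hda]
  · rw [permSum_disjoint hs hca hcb hda hdb]; simp [hca, hcb, hda, hdb]

/-- The operator with entries `permSum` maps a skew-symmetric `f` to a combination of `f` and the
differences of its row sums. -/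
theorem sum_permSum_mul (hx : ∀ i j, x j i = -x i j) (hs : ∀ i j, s j i = -s i j)
    {f : Fin n → Fin n → R} (hf : ∀ i j, f j i = -f i j) (a b : Fin n) :
    ∑ c, ∑ d, permSum x s a b c d * f c d =
      (2 * ((n - 2).factorial * ∑ i, ∑ j, x i j * s i j) -
        4 * ((n - 3).factorial *
          (∑ i, ∑ j, x i j * ∑ k, s i k - ∑ i, ∑ j, x i j * s i j))) * f a b +
      2 * ((n - 3).factorial *
          (∑ i, ∑ j, x i j * ∑ k, s i k - ∑ i, ∑ j, x i j * s i j)) *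
        (∑ d, f a d - ∑ d, f b d) := by
  by_cases hab : a = b
  · subst hab
    simp [permSum, diag_eq_zero hx, diag_eq_zero hf]
  have hneg : ∀ a, ∑ c, f c a = -∑ d, f a d := fun a => by
    rw [← Finset.sum_neg_distrib]; exact Finset.sum_congr rfl fun c _ => hf a c
  simp_rw [permSum_eq hx hs hab _ _ (permSum_self hx hab)
    (fun a b d hab hda hdb => permSum_share hx hs hab hda hdb)]
  generalize ((n - 3).factorial : R) *
    (∑ i, ∑ j, x i j * ∑ k, s i k - ∑ i, ∑ j, x i j * s i j) = B
  generalize ((n - 2).factorial : R) * ∑ i, ∑ j, x i j * s i j = K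
  have h1 : ∀ a, ∑ c, ∑ d, (if c = a then (1 : R) else 0) * f c d = ∑ d, f a d := fun a => by
    simp
  have h2 : ∀ a, ∑ c, ∑ d, (if d = a then (1 : R) else 0) * f c d = -∑ d, f a d := fun a => by
    simp [hneg]
  have h3 : ∀ a b, ∑ c, ∑ d, (if c = a then (1 : R) else 0) * (if d = b then 1 else 0) * f c d =
      f a b := fun a b => by simp
  calc _ = B * (∑ c, ∑ d, (if c = a then (1 : R) else 0) * f c d -
          ∑ c, ∑ d, (if c = b then (1 : R) else 0) * f c d -
          ∑ c, ∑ d, (if d = a then (1 : R) else 0) * f c d +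
          ∑ c, ∑ d, (if d = b then (1 : R) else 0) * f c d) +
        (K - 2 * B) * (∑ c, ∑ d, (if c = a then (1 : R) else 0) * (if d = b then 1 else 0) * f c d -
          ∑ c, ∑ d, (if c = b then (1 : R) else 0) * (if d = a then 1 else 0) * f c d) := by
        simp only [← Finset.sum_sub_distrib, ← Finset.sum_add_distrib, Finset.mul_sum]
        refine Finset.sum_congr rfl fun c _ => Finset.sum_congr rfl fun d _ => ?_
        ring
    _ = _ := by
        rw [h1, h1, h2, h2, h3, h3, hf a b]; ring

end PermSums

/-! ### The inversion statistic in terms of skew-symmetric arrays -/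

open MvPolynomial

variable {n : ℕ}

/-- The skew-symmetric array of variables: `X_{i,j}` above the diagonal, `-X_{j,i}` below it and
`0` on it. -/
noncomputable def skewVar (i j : Fin n) : PolyRing n :=
  if h : i < j then X ⟨(i, j), h⟩ else if h : j < i then -X ⟨(j, i), h⟩ else 0

/-- The sign of `j - i`, as a constant polynomial. -/
noncomputable def orderSign (i j : Fin n) : PolyRing n :=
  if i < j then 1 else if j < i then -1 else 0

theorem skewVar_swap (i j : Fin n) : skewVar j i = -skewVar i j := by
  rcases lt_trichotomy i j with h | rfl | h
  · simp [skewVar, h, h.not_gt]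
  · simp [skewVar]
  · simp [skewVar, h, h.not_gt]

theorem orderSign_swap (i j : Fin n) : orderSign j i = -orderSign i j := by
  rcases lt_trichotomy i j with h | rfl | h
  · simp [orderSign, h, h.not_gt]
  · simp [orderSign]
  · simp [orderSign, h, h.not_gt]

theorem sum_sum_eq_sum_pairs {A : Type*} [AddCommGroup A] (F : Fin n → Fin n → A)
    (hF : ∀ i, F i i = 0) :
    ∑ i, ∑ j, F i j = ∑ p : Pairs n, (F p.1.1 p.1.2 + F p.1.2 p.1.1) := by
  have hsub : ∀ G : Fin n → Fin n → A,
      ∑ p : Pairs n, G p.1.1 p.1.2 = ∑ i, ∑ j, if i < j then G i j else 0 := by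
    intro G
    rw [← Fintype.sum_prod_type' (f := fun i j => if i < j then G i j else 0),
      ← Finset.sum_filter]
    exact (Finset.sum_subtype (Finset.univ.filter fun q : Fin n × Fin n => q.1 < q.2)
      (by simp) fun q => G q.1 q.2).symm
  rw [Finset.sum_add_distrib, hsub, hsub fun i j => F j i,
    Finset.sum_comm (f := fun i j => if i < j then F j i else 0)]
  simp only [← Finset.sum_add_distrib]
  refine Finset.sum_congr rfl fun i _ => Finset.sum_congr rfl fun j _ => ?_
  rcases lt_trichotomy i j with h | rfl | h
  · simp [h, h.not_gt]
  · simp [hF]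
  · simp [h, h.not_gt]

theorem sum_sum_skewVar_mul (G : Fin n → Fin n → PolyRing n) :
    ∑ i, ∑ j, skewVar i j * G i j =
      ∑ p : Pairs n, X p * (G p.1.1 p.1.2 - G p.1.2 p.1.1) := by
  rw [sum_sum_eq_sum_pairs _ fun i => by rw [diag_eq_zero skewVar_swap, zero_mul]]
  refine Finset.sum_congr rfl fun p _ => ?_
  rw [skewVar_swap p.1.1 p.1.2]
  simp only [skewVar, p.2, dif_pos]
  ring

/-- The sum `∑_{i<j} X_{i,j}`. -/
noncomputable def varSum (n : ℕ) : PolyRing n := ∑ p : Pairs n, X p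

/-- The sum `∑_{i<j} (j - i) X_{i,j}`. -/
noncomputable def gapSum (n : ℕ) : PolyRing n :=
  ∑ p : Pairs n, C (((p.1.2 : ℕ) : ℝ) - ((p.1.1 : ℕ) : ℝ)) * X p

theorem four_mul_invX (σ : Equiv.Perm (Fin n)) :
    4 * invX σ = 2 * varSum n - ∑ i, ∑ j, skewVar i j * orderSign (σ i) (σ j) := by
  rw [sum_sum_skewVar_mul, invX, INV, Finset.sum_filter, varSum, Finset.mul_sum, Finset.mul_sum,
    ← Finset.sum_sub_distrib]
  refine Finset.sum_congr rfl fun p _ => ?_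
  rw [orderSign_swap (σ p.1.1) (σ p.1.2)]
  rcases lt_trichotomy (σ p.1.1) (σ p.1.2) with h | h | h
  · simp only [gt_iff_lt, h, h.not_gt, if_false, orderSign, if_true]; ring
  · exact absurd (σ.injective h) p.2.ne
  · simp only [gt_iff_lt, h, h.not_gt, if_false, orderSign, if_true]; ring

theorem sum_orderSign (i : Fin n) :
    ∑ k, orderSign i k = ((n : PolyRing n) - 1 - 2 * ((i : ℕ) : PolyRing n)) := by
  have h : ∀ k : Fin n, orderSign i k =
      1 - (if k = i then 1 else 0) - 2 * (if k < i then 1 else 0) := by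
    intro k
    rcases lt_trichotomy i k with h | rfl | h
    · simp [orderSign, h, h.ne', h.not_gt]
    · simp [orderSign]
    · simp [orderSign, h, h.ne, h.not_gt]; ring
  simp only [h, Finset.sum_sub_distrib, ← Finset.mul_sum]
  simp [Finset.sum_boole, Finset.filter_gt_eq_Iio]

theorem sum_sum_skewVar_mul_orderSign :
    ∑ i : Fin n, ∑ j, skewVar i j * orderSign i j = 2 * varSum n := by
  rw [sum_sum_skewVar_mul, varSum, Finset.mul_sum]
  refine Finset.sum_congr rfl fun p _ => ?_
  rw [orderSign_swap p.1.1 p.1.2]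
  simp only [orderSign, p.2, if_true]
  ring

theorem sum_sum_skewVar_mul_sum_orderSign :
    ∑ i : Fin n, ∑ j, skewVar i j * ∑ k, orderSign i k = 2 * gapSum n := by
  rw [sum_sum_skewVar_mul fun i _ => ∑ k, orderSign i k, gapSum, Finset.mul_sum]
  refine Finset.sum_congr rfl fun p _ => ?_
  simp only [sum_orderSign, map_sub, map_natCast]
  ring

/-! ### The factorization through skew-symmetric functions on pairs -/

/-- The operator `P` from functions on `[n]²` to functions on permutations, with matrix entries
`s (π a) (π b)`. -/
noncomputable def signTransform (f : Fin n → Fin n → PolyRing n) (π : Equiv.Perm (Fin n)) :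
    PolyRing n :=
  ∑ a, ∑ b, orderSign (π a) (π b) * f a b

/-- The operator `Q` from functions on permutations to functions on `[n]²`, with matrix entries
`x (τ a) (τ b)`. -/
noncomputable def varTransform (F : Equiv.Perm (Fin n) → PolyRing n) (a b : Fin n) : PolyRing n :=
  ∑ τ : Equiv.Perm (Fin n), skewVar (τ a) (τ b) * F τ

theorem varTransform_swap (F : Equiv.Perm (Fin n) → PolyRing n) (a b : Fin n) :
    varTransform F b a = -varTransform F a b := by
  simp only [varTransform, ← Finset.sum_neg_distrib]
  exact Finset.sum_congr rfl fun τ _ => by rw [skewVar_swap]; ring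

/-- The factorization of the matrix; the factor `4` avoids denominators. -/
theorem four_mul_mulVec (F : Equiv.Perm (Fin n) → PolyRing n) (π : Equiv.Perm (Fin n)) :
    4 * (invMatrix n).mulVec F π =
      2 * varSum n * ∑ τ, F τ - signTransform (varTransform F) π := by
  have hfact : ∀ τ : Equiv.Perm (Fin n),
      ∑ i, ∑ j, skewVar i j * orderSign ((π * τ⁻¹) i) ((π * τ⁻¹) j) =
        ∑ a, ∑ b, orderSign (π a) (π b) * skewVar (τ a) (τ b) := by
    intro τ
    rw [← Equiv.sum_comp τ]
    refine Finset.sum_congr rfl fun a _ => ?_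
    rw [← Equiv.sum_comp τ]
    exact Finset.sum_congr rfl fun b _ => by simp [mul_comm]
  have hPQ : signTransform (varTransform F) π =
      ∑ τ : Equiv.Perm (Fin n),
        (∑ a, ∑ b, orderSign (π a) (π b) * skewVar (τ a) (τ b)) * F τ := by
    simp only [signTransform, varTransform, Finset.mul_sum, Finset.sum_mul]
    simp_rw [Finset.sum_comm (t := (Finset.univ : Finset (Equiv.Perm (Fin n)))), mul_assoc]
  rw [hPQ, Matrix.mulVec, dotProduct, Finset.mul_sum, Finset.mul_sum, ← Finset.sum_sub_distrib]
  refine Finset.sum_congr rfl fun τ _ => ?_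
  rw [invMatrix, Matrix.of_apply, ← mul_assoc, four_mul_invX, hfact, sub_mul]

theorem sum_signTransform (f : Fin n → Fin n → PolyRing n) : ∑ π, signTransform f π = 0 := by
  have h : ∀ a b : Fin n, ∑ π : Equiv.Perm (Fin n), orderSign (π a) (π b) = 0 := by
    intro a b
    have h := Equiv.sum_comp (Equiv.mulRight (Equiv.swap a b))
      fun π : Equiv.Perm (Fin n) => orderSign (π a) (π b)
    simp only [Equiv.coe_mulRight, Equiv.Perm.mul_apply, Equiv.swap_apply_left,
      Equiv.swap_apply_right] at h
    simp_rw [fun π : Equiv.Perm (Fin n) => orderSign_swap (π a) (π b),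
      Finset.sum_neg_distrib] at h
    exact self_eq_neg.mp h.symm
  simp only [signTransform]
  simp_rw [Finset.sum_comm (s := (Finset.univ : Finset (Equiv.Perm (Fin n)))), ← Finset.sum_mul, h]
  simp

theorem varTransform_one : varTransform (1 : Equiv.Perm (Fin n) → PolyRing n) = 0 := by
  funext a b
  have h := Equiv.sum_comp (Equiv.mulRight (Equiv.swap a b))
    fun π : Equiv.Perm (Fin n) => skewVar (π a) (π b)
  simp only [Equiv.coe_mulRight, Equiv.Perm.mul_apply, Equiv.swap_apply_left,
    Equiv.swap_apply_right] at h
  simp_rw [fun π : Equiv.Perm (Fin n) => skewVar_swap (π a) (π b), Finset.sum_neg_distrib] at h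
  simpa [varTransform] using self_eq_neg.mp h.symm

/-! ### The action on skew-symmetric functions and the eigenspaces -/

theorem Lam_eq (n : ℕ) : Lam n = ((n - 2).factorial : PolyRing n) * gapSum n := by
  simp [Lam, gapSum]

theorem Del_eq (n : ℕ) :
    Del n = ((n - 3).factorial : PolyRing n) * (n * varSum n - 2 * gapSum n) := by
  rw [Del, varSum, gapSum, map_natCast, Finset.mul_sum (a := (n : PolyRing n)),
    Finset.mul_sum (a := (2 : PolyRing n)), ← Finset.sum_sub_distrib]
  congr 1
  refine Finset.sum_congr rfl fun p _ => ?_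
  simp only [map_sub, map_mul, map_natCast, map_ofNat]
  ring

theorem two_mul_Om (n : ℕ) : 2 * Om n = (n.factorial : PolyRing n) * varSum n := by
  rw [Om, varSum, ← mul_assoc]
  congr 1
  rw [show (2 : PolyRing n) = C 2 from (map_ofNat C 2).symm, ← C_mul,
    mul_div_cancel₀ _ (two_ne_zero' ℝ), map_natCast]

/-- The coefficient `(n-3)! ∑_{i<j} (j - i - 1) X_{i,j}` of the row-sum differences in
`varTransform_signTransform`; it equals `(Λ - Δ) / n`. -/
noncomputable def gapExcess (n : ℕ) : PolyRing n :=
  ((n - 3).factorial : PolyRing n) * (gapSum n - varSum n)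

theorem Lam_eq_Del_add (hn : 3 ≤ n) : Lam n = Del n + n * gapExcess n := by
  obtain ⟨m, rfl⟩ := Nat.exists_eq_add_of_le' hn
  rw [Lam_eq, Del_eq, gapExcess, show m + 3 - 2 = m + 1 from rfl, Nat.add_sub_cancel,
    Nat.factorial_succ]
  push_cast
  ring

theorem varTransform_signTransform (hn : 3 ≤ n) {f : Fin n → Fin n → PolyRing n}
    (hf : ∀ i j, f j i = -f i j) (a b : Fin n) :
    varTransform (signTransform f) a b =
      4 * (Del n * f a b + gapExcess n * (∑ d, f a d - ∑ d, f b d)) := by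
  have h := sum_permSum_mul skewVar_swap orderSign_swap hf a b
  rw [sum_sum_skewVar_mul_orderSign, sum_sum_skewVar_mul_sum_orderSign] at h
  have hPQ : varTransform (signTransform f) a b =
      ∑ c, ∑ d, permSum skewVar orderSign a b c d * f c d := by
    simp only [signTransform, varTransform, permSum, Finset.mul_sum, Finset.sum_mul]
    simp_rw [Finset.sum_comm (s := (Finset.univ : Finset (Equiv.Perm (Fin n)))), mul_assoc]
  rw [hPQ, h, Del_eq, gapExcess]
  obtain ⟨m, rfl⟩ := Nat.exists_eq_add_of_le' hn
  rw [show m + 3 - 2 = m + 1 from rfl, Nat.add_sub_cancel, Nat.factorial_succ]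
  push_cast
  ring

theorem signTransform_combination (c d : PolyRing n) (f g : Fin n → Fin n → PolyRing n)
    (π : Equiv.Perm (Fin n)) :
    signTransform (fun a b => c * f a b + d * g a b) π =
      c * signTransform f π + d * signTransform g π := by
  simp only [signTransform, Finset.mul_sum, ← Finset.sum_add_distrib]
  exact Finset.sum_congr rfl fun a _ => Finset.sum_congr rfl fun b _ => by ring

theorem mulVec_signTransform (hn : 3 ≤ n) {f : Fin n → Fin n → PolyRing n}
    (hf : ∀ i j, f j i = -f i j) :
    (invMatrix n).mulVec (signTransform f) = -(Del n • signTransform f) -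
      gapExcess n • signTransform fun a b => ∑ d, f a d - ∑ d, f b d := by
  funext π
  refine mul_left_cancel₀ (by norm_num : (4 : PolyRing n) ≠ 0) ?_
  rw [four_mul_mulVec, sum_signTransform, funext₂ (varTransform_signTransform hn hf)]
  simp only [mul_add, ← mul_assoc]
  rw [signTransform_combination]
  simp only [Pi.sub_apply, Pi.neg_apply, Pi.smul_apply, smul_eq_mul]
  ring

/-- For `f a b = h a - h b` the row-sum differences are `n * f`, whence an eigenvector. -/
theorem mulVec_signTransform_sub (hn : 3 ≤ n) (h : Fin n → PolyRing n) :
    (invMatrix n).mulVec (signTransform fun a b => h a - h b) =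
      -Lam n • signTransform fun a b => h a - h b := by
  have hg : (fun a b : Fin n => ∑ d, (h a - h d) - ∑ d, (h b - h d)) =
      fun a b => (n : PolyRing n) * (h a - h b) + 0 * (h a - h b) := by
    funext a b
    simp only [Finset.sum_sub_distrib, Finset.sum_const, Finset.card_univ, Fintype.card_fin,
      nsmul_eq_mul]
    ring
  rw [mulVec_signTransform hn fun i j => by ring, Lam_eq_Del_add hn, hg]
  funext π
  simp only [Pi.sub_apply, Pi.neg_apply, Pi.smul_apply, smul_eq_mul, signTransform_combination]
  ring

theorem mulVec_one : (invMatrix n).mulVec 1 = Om n • 1 := by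
  funext π
  refine mul_left_cancel₀ (by norm_num : (4 : PolyRing n) ≠ 0) ?_
  rw [four_mul_mulVec, varTransform_one]
  simp only [signTransform, Pi.one_apply, Pi.zero_apply, mul_zero, Finset.sum_const_zero, sub_zero,
    Finset.sum_const, Finset.card_univ, Fintype.card_perm, Fintype.card_fin, nsmul_eq_mul,
    Pi.smul_apply, smul_eq_mul]
  linear_combination -2 * two_mul_Om n

/-! ### The annihilating polynomial -/

theorem aeval_quarticPoly (hn : 3 ≤ n) :
    Polynomial.aeval (invMatrix n) (quarticPoly n) = 0 := by
  set E := Matrix.toLinAlgEquiv' (invMatrix n) with hE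
  have hEv : ∀ F, E F = (invMatrix n).mulVec F := fun F => Matrix.toLinAlgEquiv'_apply _ _
  rw [← map_eq_zero_iff Matrix.toLinAlgEquiv' (AlgEquiv.injective _),
    ← Polynomial.aeval_algHom_apply, ← hE]
  -- `A` kills the constant function and every `signTransform f` with `f` skew-symmetric, and
  -- `4 E F` is always a combination of two such functions.
  set A : Module.End (PolyRing n) (Equiv.Perm (Fin n) → PolyRing n) :=
    Polynomial.aeval E ((Polynomial.X + Polynomial.C (Lam n)) *
      (Polynomial.X + Polynomial.C (Del n)) * (Polynomial.X - Polynomial.C (Om n))) with hA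
  have hone : A 1 = 0 := by
    have h : (Polynomial.aeval E (Polynomial.X - Polynomial.C (Om n))) 1 = 0 := by
      simp [Algebra.algebraMap_eq_smul_one, hEv, mulVec_one]
    rw [hA, Polynomial.aeval_mul, Module.End.mul_apply, h, map_zero]
  have hsign : ∀ f : Fin n → Fin n → PolyRing n, (∀ i j, f j i = -f i j) →
      A (signTransform f) = 0 := by
    intro f hf
    rw [hA, mul_comm, Polynomial.aeval_mul, Polynomial.aeval_mul, Module.End.mul_apply,
      Module.End.mul_apply]
    have h1 : (Polynomial.aeval E (Polynomial.X + Polynomial.C (Del n))) (signTransform f) =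
        -(gapExcess n • signTransform fun a b => ∑ d, f a d - ∑ d, f b d) := by
      simp only [map_add, Polynomial.aeval_X, Polynomial.aeval_C, Algebra.algebraMap_eq_smul_one,
        LinearMap.add_apply, LinearMap.smul_apply, Module.End.one_apply, hEv,
        mulVec_signTransform hn hf]
      abel
    have h2 : (Polynomial.aeval E (Polynomial.X + Polynomial.C (Lam n)))
        (signTransform fun a b => ∑ d, f a d - ∑ d, f b d) = 0 := by
      simp [Algebra.algebraMap_eq_smul_one, hEv,
        mulVec_signTransform_sub hn fun a => ∑ d, f a d]
    rw [h1, map_neg, map_smul, h2, smul_zero, neg_zero, map_zero]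
  have hquart : quarticPoly n = (Polynomial.X + Polynomial.C (Lam n)) *
      (Polynomial.X + Polynomial.C (Del n)) * (Polynomial.X - Polynomial.C (Om n)) *
        Polynomial.X := by
    rw [quarticPoly]; ring
  refine LinearMap.ext fun F => ?_
  rw [hquart, Polynomial.aeval_mul, ← hA, Polynomial.aeval_X, Module.End.mul_apply,
    LinearMap.zero_apply]
  have h4 : (4 : PolyRing n) • E F = (2 * varSum n * ∑ τ, F τ) • 1 -
      signTransform (varTransform F) := by
    funext π
    simp [hEv, four_mul_mulVec]
  have h5 := congrArg A h4
  rw [map_smul, map_sub, map_smul, hone, hsign _ (varTransform_swap F), smul_zero, sub_zero] at h5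
  exact (smul_eq_zero.mp h5).resolve_left (by norm_num)

/-! ### Eigenvectors and distinctness of the eigenvalues -/

theorem mulVec_sign (hn : 4 ≤ n) :
    (invMatrix n).mulVec (fun τ => ((Equiv.Perm.sign τ : ℤ) : PolyRing n)) = 0 := by
  -- Two further indices `c, d` outside `{a, b}` exist since `n ≥ 4`; swapping them changes the
  -- sign.
  have hvar : varTransform (fun τ => ((Equiv.Perm.sign τ : ℤ) : PolyRing n)) = 0 := by
    funext a b
    obtain ⟨c, hc⟩ : ∃ c, c ∉ ({a, b} : Finset (Fin n)) := by
      by_contra! h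
      have := Finset.card_le_card (fun c _ => h c : Finset.univ ⊆ ({a, b} : Finset (Fin n)))
      have h2 := Finset.card_le_two (a := a) (b := b)
      simp only [Finset.card_univ, Fintype.card_fin] at this
      omega
    obtain ⟨d, hd⟩ : ∃ d, d ∉ ({a, b, c} : Finset (Fin n)) := by
      by_contra! h
      have := Finset.card_le_card (fun c _ => h c : Finset.univ ⊆ ({a, b, c} : Finset (Fin n)))
      have h2 := Finset.card_le_three (a := a) (b := b) (c := c)
      simp only [Finset.card_univ, Fintype.card_fin] at this
      omega
    simp only [Finset.mem_insert, Finset.mem_singleton, not_or] at hc hd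
    have h := Equiv.sum_comp (Equiv.mulRight (Equiv.swap c d)) fun τ : Equiv.Perm (Fin n) =>
      skewVar (τ a) (τ b) * ((Equiv.Perm.sign τ : ℤ) : PolyRing n)
    simp only [Equiv.coe_mulRight, Equiv.Perm.mul_apply, Equiv.Perm.sign_mul,
      Equiv.Perm.sign_swap (Ne.symm hd.2.2),
      Equiv.swap_apply_of_ne_of_ne (Ne.symm hc.1) (Ne.symm hd.1),
      Equiv.swap_apply_of_ne_of_ne (Ne.symm hc.2) (Ne.symm hd.2.1)] at h
    simp only [mul_neg, mul_one, Units.val_neg, Int.cast_neg, Finset.sum_neg_distrib] at h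
    exact self_eq_neg.mp h.symm
  have hsum : ∑ τ : Equiv.Perm (Fin n), ((Equiv.Perm.sign τ : ℤ) : PolyRing n) = 0 := by
    have h := Equiv.sum_comp (Equiv.mulRight (Equiv.swap (⟨0, by omega⟩ : Fin n) ⟨1, by omega⟩))
      fun τ : Equiv.Perm (Fin n) => ((Equiv.Perm.sign τ : ℤ) : PolyRing n)
    simp only [Equiv.coe_mulRight, Equiv.Perm.sign_mul,
      Equiv.Perm.sign_swap (show (⟨0, by omega⟩ : Fin n) ≠ ⟨1, by omega⟩ by simp)] at h
    simp only [mul_neg, mul_one, Units.val_neg, Int.cast_neg, Finset.sum_neg_distrib] at h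
    exact self_eq_neg.mp h.symm
  funext π
  refine mul_left_cancel₀ (by norm_num : (4 : PolyRing n) ≠ 0) ?_
  rw [four_mul_mulVec, hvar, hsum]
  simp [signTransform]

/-- An eigenvector of `Q P` with nonzero eigenvalue is not in the kernel of `P`. -/
theorem signTransform_ne_zero {f : Fin n → Fin n → PolyRing n} {c : PolyRing n} (hc : c ≠ 0)
    (hf : ∀ a b, varTransform (signTransform f) a b = 4 * (c * f a b)) {a b : Fin n}
    (hab : f a b ≠ 0) : signTransform f ≠ 0 := by
  intro h
  have h1 := hf a b
  rw [h] at h1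
  have h2 : (4 : PolyRing n) * (c * f a b) = 0 := by
    rw [← h1]; simp [varTransform]
  exact mul_ne_zero (by norm_num) (mul_ne_zero hc hab) h2

theorem eval_Lam (p : Pairs n) :
    eval (Pi.single p 1) (Lam n) =
      ((n - 2).factorial : ℝ) * (((p.1.2 : ℕ) : ℝ) - ((p.1.1 : ℕ) : ℝ)) := by
  simp [Lam, Pi.single_apply]

theorem eval_Del (p : Pairs n) :
    eval (Pi.single p 1) (Del n) = ((n - 3).factorial : ℝ) *
      ((n : ℝ) - 2 * (((p.1.2 : ℕ) : ℝ) - ((p.1.1 : ℕ) : ℝ))) := by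
  simp [Del, Pi.single_apply]

theorem eval_Om (p : Pairs n) : eval (Pi.single p 1) (Om n) = (n.factorial : ℝ) / 2 := by
  simp [Om, Pi.single_apply]

theorem eigenvalues_nodup (hn : 4 ≤ n) :
    ({0, -Lam n, -Del n, Om n} : Multiset (PolyRing n)).Nodup := by
  -- The coefficients at `X_{1,2}` separate all pairs except `Lam` and `Del`, where both are
  -- `(n - 2)!`; those two are separated by the coefficients at `X_{1,3}`.
  let p : Pairs n := ⟨(⟨0, by omega⟩, ⟨1, by omega⟩), by simp⟩
  let q : Pairs n := ⟨(⟨0, by omega⟩, ⟨2, by omega⟩), by simp⟩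
  have hΛ : 0 < eval (Pi.single p 1) (Lam n) := by
    rw [eval_Lam]; simp [p, Nat.factorial_pos]
  have hΔ : 0 < eval (Pi.single p 1) (Del n) := by
    rw [eval_Del]
    have : (4 : ℝ) ≤ n := by exact_mod_cast hn
    refine mul_pos (by positivity) ?_
    simp only [p]; push_cast; linarith
  have hΩ : 0 < eval (Pi.single p 1) (Om n) := by
    rw [eval_Om]; positivity
  have hΛΔ : eval (Pi.single q 1) (Lam n) ≠ eval (Pi.single q 1) (Del n) := by
    obtain ⟨m, rfl⟩ := Nat.exists_eq_add_of_le' hn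
    rw [eval_Lam, eval_Del, show m + 4 - 2 = m + 1 + 1 from rfl, show m + 4 - 3 = m + 1 from rfl,
      Nat.factorial_succ (m + 1)]
    have : (0 : ℝ) < ((m + 1).factorial : ℝ) := by positivity
    simp only [q]
    push_cast
    nlinarith [mul_nonneg this.le (Nat.cast_nonneg (α := ℝ) m)]
  have hne : ∀ {P Q : PolyRing n} (v : Pairs n → ℝ), eval v P ≠ eval v Q → P ≠ Q :=
    fun v h e => h (congrArg (eval v) e)
  have h1 : 0 ≠ -Lam n := hne (Pi.single p 1) (by rw [map_zero, map_neg]; linarith)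
  have h2 : 0 ≠ -Del n := hne (Pi.single p 1) (by rw [map_zero, map_neg]; linarith)
  have h3 : 0 ≠ Om n := hne (Pi.single p 1) (by rw [map_zero]; exact hΩ.ne)
  have h4 : -Lam n ≠ -Del n := fun h => hne (Pi.single q 1) hΛΔ (neg_injective h)
  have h5 : -Lam n ≠ Om n := hne (Pi.single p 1) (by rw [map_neg]; linarith)
  have h6 : -Del n ≠ Om n := hne (Pi.single p 1) (by rw [map_neg]; linarith)
  simp only [Multiset.insert_eq_cons, Multiset.nodup_cons, Multiset.mem_cons,
    Multiset.mem_singleton, Multiset.nodup_singleton, not_or, and_true]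
  exact ⟨⟨h1, h2, h3⟩, ⟨h4, h5⟩, h6⟩

theorem exists_eigenvector (hn : 4 ≤ n) {c : PolyRing n}
    (hc : c ∈ ({0, -Lam n, -Del n, Om n} : Multiset (PolyRing n))) :
    ∃ v, v ≠ 0 ∧ (invMatrix n).mulVec v = c • v := by
  have hnodup := eigenvalues_nodup hn
  simp only [Multiset.insert_eq_cons, Multiset.nodup_cons, Multiset.mem_cons,
    Multiset.mem_singleton, Multiset.nodup_singleton, not_or, and_true] at hnodup hc
  let i : Fin n := ⟨0, by omega⟩
  let j : Fin n := ⟨1, by omega⟩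
  let k : Fin n := ⟨2, by omega⟩
  have hij : i ≠ j := by simp [i, j]
  have hik : i ≠ k := by simp [i, k]
  have hjk : j ≠ k := by simp [j, k]
  rcases hc with rfl | rfl | rfl | rfl
  · refine ⟨_, fun h => ?_, (mulVec_sign hn).trans (zero_smul _ _).symm⟩
    simpa using congrFun h 1
  · let e : Fin n → PolyRing n := Pi.single i 1
    refine ⟨_, ?_, mulVec_signTransform_sub (by omega) e⟩
    have hΛ : Lam n ≠ 0 := fun h => hnodup.1.1 (by rw [h, neg_zero])
    refine signTransform_ne_zero hΛ (fun a b => ?_) (a := i) (b := j) (by simp [e, hij])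
    rw [varTransform_signTransform (by omega) (fun i j => by ring), Lam_eq_Del_add (by omega)]
    simp only [Finset.sum_sub_distrib, Finset.sum_const, Finset.card_univ, Fintype.card_fin,
      nsmul_eq_mul]
    ring
  · -- `f = u ∧ v` with `u, v` of coordinate sum zero has zero row sums.
    let u : Fin n → PolyRing n := Pi.single i 1 - Pi.single j 1
    let v : Fin n → PolyRing n := Pi.single j 1 - Pi.single k 1
    let f : Fin n → Fin n → PolyRing n := fun a b => u a * v b - u b * v a
    have hskew : ∀ a b, f b a = -f a b := fun a b => by simp only [f]; ring
    have hrow : ∀ a, ∑ d, f a d = 0 := by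
      intro a
      simp [f, u, v, Finset.sum_sub_distrib, ← Finset.mul_sum, ← Finset.sum_mul]
    refine ⟨signTransform f, ?_, ?_⟩
    · have hΔ : Del n ≠ 0 := fun h => hnodup.1.2.1 (by rw [h, neg_zero])
      refine signTransform_ne_zero hΔ (fun a b => ?_) (a := i) (b := k) ?_
      · rw [varTransform_signTransform (by omega) hskew, hrow, hrow]; ring
      · simp [f, u, v, hij, hik, hjk.symm, hik.symm]
    · rw [mulVec_signTransform (by omega) hskew]
      simp only [hrow, sub_zero]
      funext π
      simp [signTransform]
  · exact ⟨1, one_ne_zero, mulVec_one⟩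

/-! ### Divisibility -/

theorem quarticPoly_eq_prod (n : ℕ) :
    quarticPoly n = (({0, -Lam n, -Del n, Om n} : Multiset (PolyRing n)).map
      fun a => Polynomial.X - Polynomial.C a).prod := by
  simp [quarticPoly, mul_assoc]

theorem quarticPoly_dvd_of_aeval_eq_zero (hn : 4 ≤ n) {q : Polynomial (PolyRing n)}
    (hq : Polynomial.aeval (invMatrix n) q = 0) : quarticPoly n ∣ q := by
  by_cases hq0 : q = 0
  · exact hq0 ▸ dvd_zero _
  rw [quarticPoly_eq_prod, Multiset.prod_X_sub_C_dvd_iff_le_roots hq0,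
    Multiset.le_iff_subset (eigenvalues_nodup hn)]
  intro c hc
  obtain ⟨v, hv, hMv⟩ := exists_eigenvector hn hc
  have h := Module.End.aeval_apply_of_hasEigenvector (p := q)
    (f := Matrix.toLinAlgEquiv' (invMatrix n)) (μ := c) (x := v)
    ⟨Module.End.mem_eigenspace_iff.mpr ((Matrix.toLinAlgEquiv'_apply _ _).trans hMv), hv⟩
  rw [Polynomial.aeval_algHom_apply, hq, map_zero, LinearMap.zero_apply] at h
  exact (Polynomial.mem_roots hq0).mpr ((smul_eq_zero.mp h.symm).resolve_right hv)

end MultinomialInversion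

/-- The polynomial is Mathlib's minimal polynomial of the matrix (monic, annihilating, of least
degree), and it generates the ideal of all polynomials that annihilate the matrix. The second part
is stated too, since over a ring that is not a field it is not part of the definition of
`minpoly`. -/
theorem proposition4p8 (n : ℕ) (hn : 4 ≤ n) :
    minpoly (MultinomialInversion.PolyRing n) (MultinomialInversion.invMatrix n) =
        MultinomialInversion.quarticPoly n ∧
      ∀ q : Polynomial (MultinomialInversion.PolyRing n),
        Polynomial.aeval (MultinomialInversion.invMatrix n) q = 0 ↔
          MultinomialInversion.quarticPoly n ∣ q := by
  have hann := MultinomialInversion.aeval_quarticPoly (n := n) (by omega)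
  have hmonic : (MultinomialInversion.quarticPoly n).Monic := by
    rw [MultinomialInversion.quarticPoly_eq_prod]
    exact Polynomial.monic_multiset_prod_of_monic _ _ fun c _ => Polynomial.monic_X_sub_C c
  refine ⟨(minpoly.unique' _ _ hmonic hann fun q hq => ?_).symm, fun q =>
    ⟨MultinomialInversion.quarticPoly_dvd_of_aeval_eq_zero hn, ?_⟩⟩
  · by_contra! h
    exact h.1 (Polynomial.eq_zero_of_dvd_of_degree_lt
      (MultinomialInversion.quarticPoly_dvd_of_aeval_eq_zero hn h.2) hq)
  · rintro ⟨r, rfl⟩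
    rw [Polynomial.aeval_mul, hann, zero_mul]
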